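/- Let $\mathbb{K}$ be a field. For polynomials $f=f_mx^m+\cdots+f_0$ and $g=g_nx^n+\cdots+g_0$ in $\mathbb{K}[x]$ with $f_m\ne 0$, $g_n\neq 0$, and $0\le d<\min\{m,n\}$, the order-$d$ subresultant $\operatorname{Sres}_d(f,g)\in\mathbb{K}[x]$ is the determinant of the square matrix of size $N=m+n-2d$ whose first $n-d$ rows are $$\bigl(f_{m+i},\,f_{m+i-1},\,\dots,\,f_{m+i-N+2},\;x^{n-d-1-i}f\bigr),\qquad 0\le i\le n-d-1,$$ and whose last $m-d$ rows are $$\bigl(g_{n+i},\,g_{n+i-1},\,\dots,\,g_{n+i-N+2},\;x^{m-d-1-i}g\bigr),\qquad 0\le i\le m-d-1,$$ where $f_\ell=0$ if $\ell<0$ or $\ell>m$, and $g_\ell=0$ if $\ell<0$ or $\ell>n$. For $m,n,d\in\mathbb{N}$ with $0\le d<\min\{m,n\}$ put $c=m+n-2d-1$ and let $H(m,n,d)$ be the $d\times(d+1)$ integer matrix $$H(m,n,d)=\left(\binom{c}{m-i-j}\right)_{1\le i\le d,\;0\le j\le d},$$ where $\binom{c}{k}=0$ for $k<0$ and for $k>c$.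 For $0\le j\le d$ let $q_j(m,n,d)\in\mathbb{Z}$ be the determinant of the $d\times d$ matrix obtained from $H(m,n,d)$ by deleting its $(j+1)$-th column (so $q_0(m,n,0)=1$, the determinant of an empty matrix). These integers are regarded as elements of $\mathbb{K}$ through the ring homomorphism $\mathbb{Z}\to\mathbb{K}$. **Theorem.** Let $m,n,d\in\mathbb{N}$ with $0\le d<\min\{m,n\}$, and let $\alpha,\beta\in\mathbb{K}$. Then $$\operatorname{Sres}_d\bigl((x-\alpha)^m,(x-\beta)^n\bigr)=(-1)^{\binom d2}(\alpha-\beta)^{(m-d)(n-d)}\sum_{j=0}^d q_j(m,n,d)\,(x-\alpha)^j(x-\beta)^{d-j}.$$ -/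

import Mathlib

open Polynomial

noncomputable section

/-- The coefficient `f_k` of `x ^ k` in `f`, with the convention `f_k = 0` for `k < 0`. -/
def intCoeff {R : Type*} [CommRing R] (f : R[X]) (k : ℤ) : R :=
  if 0 ≤ k then f.coeff k.toNat else 0

/-- Row `i` (with `0 ≤ i < L`) of a block of `L` shifted rows, of length `N`, attached to a
polynomial `h` of degree `e`:
the row `(h_(e+i), h_(e+i-1), …, h_(e+i-N+2), x ^ (L-1-i) * h)`. -/
def sresRow {R : Type*} [CommRing R] (h : R[X]) (e L N : ℕ) (i : Fin L) (k : Fin N) : R[X] :=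
  if (k : ℕ) + 1 = N then X ^ (L - 1 - (i : ℕ)) * h
  else C (intCoeff h ((e : ℤ) + (i : ℕ) - (k : ℕ)))

/-- The square matrix of size `m + n - 2 * d = (n - d) + (m - d)` whose determinant is the
order-`d` subresultant of `f` (of degree `m`) and `g` (of degree `n`), for `d < min m n`:
`n - d` rows coming from `f`, followed by `m - d` rows coming from `g`. -/
def sresMatrix {R : Type*} [CommRing R] (f g : R[X]) (m n d : ℕ) :
    Matrix (Fin ((n - d) + (m - d))) (Fin ((n - d) + (m - d))) R[X] :=
  Matrix.of fun i k =>
    Fin.addCases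
      (fun i₁ : Fin (n - d) => sresRow f m (n - d) ((n - d) + (m - d)) i₁ k)
      (fun i₂ : Fin (m - d) => sresRow g n (m - d) ((n - d) + (m - d)) i₂ k) i

/-- The order-`d` subresultant of `f` and `g`, for `d < min (deg f) (deg g)`. -/
def sres {R : Type*} [CommRing R] (d : ℕ) (f g : R[X]) : R[X] :=
  (sresMatrix f g f.natDegree g.natDegree d).det

/-- The binomial coefficient `c` over `k` for an integer `k`, equal to `0` for `k < 0`
(and for `k > c`). -/
def intBinom (c : ℕ) (k : ℤ) : ℤ :=
  if 0 ≤ k then (c.choose k.toNat : ℤ) else 0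

/-- The `d × (d + 1)` Hankel matrix with entries `c` over `m - i - j`, for `1 ≤ i ≤ d` and
`0 ≤ j ≤ d`, where `c = m + n - 2 * d - 1` (a natural number as soon as `d < min m n`).
Rows are indexed here from `0`. -/
def binomHankel (m n d : ℕ) : Matrix (Fin d) (Fin (d + 1)) ℤ :=
  Matrix.of fun i j =>
    intBinom (m + n - 2 * d - 1) ((m : ℤ) - ((i : ℕ) + 1) - (j : ℕ))

/-- The `j`-th maximal minor `q_j(m, n, d)`, `0 ≤ j ≤ d`: the determinant of the matrix obtained
from the Hankel matrix by deleting its column of index `j`. -/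
def hankelMinor (m n d : ℕ) (j : Fin (d + 1)) : ℤ :=
  ((binomHankel m n d).submatrix id j.succAbove).det

end

/-!
The subresultant is a determinant on the space of polynomials in an auxiliary variable `t` of degree
less than `M = m + n - d`, written with `X` for `t` and `ξ` for the variable of the subresultant.
Its matrix lists, for the polynomials `t ^ i * f` and `t ^ j * g`, the top coefficients and the
value at `ξ`; since `(ξ - t) * t ^ k`, `k < d`, span the common kernel of these functionals,
inserting them as rows between the two blocks gives, up to sign, the full determinant of
coefficients (`det_evalMatrix`, `det_sresMatrix`).

For `f = (t - α) ^ m` and `g = (t - β) ^ n` put `a = α - t`, `b = t - β`. The polynomials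
`a ^ i * b ^ (L - 1 - i)` are a basis in degree less than `L`, with determinant
`(β - α) ^ (L choose 2)` (`det_coeffMatrix_pencil`). Passing to these bases in each of the three
blocks of rows and in the whole space turns the `f`-rows and the `g`-rows into basis vectors.
The middle rows become manageable because of
`(α - β) * (ξ - t) = (ξ - α) * b + (ξ - β) * a` and `a + b = α - β`: after multiplication by a power
of `α - β`, they are `a ^ k * b ^ (d - 1 - k) * (a + b) ^ c * ((ξ - α) * b + (ξ - β) * a)` with
`c = m + n - 2 * d - 1`. What is left is the `d × d` determinant of the middle coefficients of these
forms (`det_blockRows_mul`), whose entries are combinations of two adjacent entries of the binomial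
Hankel matrix. So it is the determinant of the product of the Hankel matrix with a bidiagonal
matrix, and expands into the Hankel minors (`sum_hankelMinor`).

The comparison of bases determines the result only up to a power of `α - β`. The case `α = β` is
therefore reached by deforming `α` to `α + Y` over `K[Y]` and setting `Y = 0`.
-/

/-! ### Determinants of coefficients and homogeneous substitution -/

section CoeffMatrix
variable {R : Type*} [CommRing R] {ι : Type*}

/-- The square matrix of the coefficients of the polynomials `P i`, the columns being labelled by
the exponents `0, …, L - 1` through `σ`. -/
def coeffMatrix {L : ℕ} (σ : ι ≃ Fin L) (P : ι → R[X]) : Matrix ι ι R :=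
  Matrix.of fun i j => (P i).coeff (σ j : ℕ)

theorem coeffMatrix_eq_mul [Fintype ι] {L : ℕ} (σ : ι ≃ Fin L) (P Q : ι → R[X])
    (c : Matrix ι ι R) (h : ∀ i, Q i = ∑ j, C (c i j) * P j) :
    coeffMatrix σ Q = c * coeffMatrix σ P := by
  ext i j
  simp [coeffMatrix, Matrix.mul_apply, h]

/-- The forms of degree `L - 1` in the pencil `α - X`, `X - β` have determinant
`(β - α) ^ (L choose 2)`: adding each to the next one produces `α - β` times the forms of degree
`L - 2`, since `(α - X) + (X - β) = α - β`. -/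
theorem det_coeffMatrix_pencil (a b : R[X]) (α β : R) (ha : a = C α - X) (hb : b = X - C β)
    (L : ℕ) :
    (coeffMatrix (Equiv.refl (Fin L)) fun i => a ^ (i : ℕ) * b ^ (L - 1 - (i : ℕ))).det =
      (-(α - β)) ^ (L.choose 2) := by
  nontriviality R
  have hab : a + b = C (α - β) := by rw [ha, hb, C_sub]; ring
  have hbm : b.Monic := hb ▸ monic_X_sub_C β
  have hb1 : b.natDegree = 1 := hb ▸ natDegree_X_sub_C β
  have ha1 : a.natDegree ≤ 1 := by
    rw [ha, ← neg_sub, natDegree_neg, natDegree_X_sub_C]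
  induction L with
  | zero => simp
  | succ L ih =>
    -- adding each row to the next one turns every row but the first into a multiple of `α - β`
    let B : Matrix (Fin (L + 1)) (Fin (L + 1)) R := Matrix.of fun i j =>
      Fin.cases (motive := fun _ => R) ((b ^ L).coeff j)
        (fun i' : Fin L => (α - β) * (a ^ (i' : ℕ) * b ^ (L - 1 - (i' : ℕ))).coeff j) i
    have hdet : (coeffMatrix (Equiv.refl (Fin (L + 1)))
        fun i => a ^ (i : ℕ) * b ^ (L + 1 - 1 - (i : ℕ))).det = B.det := by
      apply Matrix.det_eq_of_forall_row_eq_smul_add_pred (fun _ => -1)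
      · intro j; simp [B, coeffMatrix]
      · intro i j
        have e : L + 1 - 1 - (i : ℕ) = (L - 1 - (i : ℕ)) + 1 := by omega
        have e' : L + 1 - 1 - ((i : ℕ) + 1) = L - 1 - (i : ℕ) := by omega
        have key : a ^ ((i : ℕ) + 1) * b ^ (L - 1 - (i : ℕ)) =
            C (α - β) * (a ^ (i : ℕ) * b ^ (L - 1 - (i : ℕ))) +
              C (-1) * (a ^ (i : ℕ) * b ^ (L - 1 - (i : ℕ) + 1)) := by
          rw [← hab, C_neg, C_1]; ring
        simp only [B, coeffMatrix, Matrix.of_apply, e, e', Fin.val_succ, Fin.val_castSucc,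
          Fin.cases_succ, key, coeff_add, coeff_C_mul, Equiv.refl_apply]
    rw [hdet, Matrix.det_succ_column _ (Fin.last L), Finset.sum_eq_single 0]
    · have hm : B.submatrix (Fin.succAbove 0) (Fin.last L).succAbove = (α - β) •
          coeffMatrix (Equiv.refl (Fin L)) fun i => a ^ (i : ℕ) * b ^ (L - 1 - (i : ℕ)) := by
        ext i j
        simp [B, coeffMatrix]
      have h0 : B 0 (Fin.last L) = 1 := by
        have : (b ^ L).natDegree = L := by rw [hbm.natDegree_pow, hb1, mul_one]
        have h2 := (hbm.pow L).coeff_natDegree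
        rw [this] at h2
        simpa [B] using h2
      rw [hm, h0, Matrix.det_smul, ih, Nat.choose_succ_succ', Nat.choose_one_right,
        pow_add (-(α - β)), neg_pow (α - β) L]
      simp [mul_assoc]
    · intro i _ hi
      obtain ⟨i, rfl⟩ := Fin.exists_succ_eq.2 hi
      have : (a ^ (i : ℕ) * b ^ (L - 1 - (i : ℕ))).coeff L = 0 := by
        apply coeff_eq_zero_of_natDegree_lt
        have h1 := natDegree_mul_le (p := a ^ (i : ℕ)) (q := b ^ (L - 1 - (i : ℕ)))
        have h2 := natDegree_pow_le_of_le (i : ℕ) ha1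
        have h3 := natDegree_pow_le_of_le (L - 1 - (i : ℕ)) hb1.le
        have := i.2
        omega
      simp [B, this]
    · simp

theorem det_coeffMatrix_pencil_equiv [Fintype ι] [DecidableEq ι] {L : ℕ} (σ : ι ≃ Fin L)
    (a b : R[X]) (α β : R) (ha : a = C α - X) (hb : b = X - C β) :
    (coeffMatrix σ fun i => a ^ (σ i : ℕ) * b ^ (L - 1 - (σ i : ℕ))).det =
      (-(α - β)) ^ (L.choose 2) := by
  rw [← det_coeffMatrix_pencil a b α β ha hb L, ← Matrix.det_submatrix_equiv_self σ]
  rfl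

/-- `b ^ (L - 1) * h (a / b)`, for a polynomial `h` of degree less than `L`. -/
noncomputable def homSubst (L : ℕ) (a b h : R[X]) : R[X] :=
  ∑ j : Fin L, C (h.coeff j) * (a ^ (j : ℕ) * b ^ (L - 1 - (j : ℕ)))

theorem homSubst_succ (n : ℕ) (a b h : R[X]) :
    homSubst (n + 1) a b h = MvPolynomial.aeval ![a, b] (h.homogenize n) := by
  rw [homSubst, homogenize, map_sum, Finset.Nat.sum_antidiagonal_eq_sum_range_succ_mk,
    Finset.sum_range]
  refine Finset.sum_congr rfl fun j _ => ?_
  rw [MvPolynomial.aeval_monomial, Finsupp.prod_fintype _ _ (by simp)]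
  simp [Fin.prod_univ_two]

/-- Homogeneous substitution of the pencil `α - X`, `X - β` multiplies the determinant
of coefficients by that of the pencil. -/
theorem det_coeffMatrix_homSubst [Fintype ι] [DecidableEq ι] {L : ℕ} (σ : ι ≃ Fin L)
    (a b : R[X]) (α β : R) (ha : a = C α - X) (hb : b = X - C β) (h : ι → R[X]) :
    (coeffMatrix σ fun i => homSubst L a b (h i)).det =
      (coeffMatrix σ h).det * (-(α - β)) ^ (L.choose 2) := by
  rw [← det_coeffMatrix_pencil_equiv σ a b α β ha hb, ← Matrix.det_mul]
  congr 1
  apply coeffMatrix_eq_mul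
  intro i
  rw [homSubst, ← Equiv.sum_comp σ]
  rfl

theorem homSubst_X_pow (L k : ℕ) (hk : k < L) (a b : R[X]) :
    homSubst L a b (X ^ k) = a ^ k * b ^ (L - 1 - k) := by
  rw [homSubst, Finset.sum_eq_single ⟨k, hk⟩]
  · simp
  · intro j _ hj
    have : (j : ℕ) ≠ k := fun h => hj (Fin.ext h)
    simp [coeff_X_pow, this]
  · simp

theorem homSubst_binomial (k c r : ℕ) (u v : R) (a b : R[X]) :
    homSubst (k + (c + 1) + r + 1) a b (X ^ k * ((1 + X) ^ c * (C u + C v * X))) =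
      a ^ k * b ^ r * ((a + b) ^ c * (C u * b + C v * a)) := by
  have hX : (1 + X : R[X]).homogenize 1 = .X 1 + .X 0 := by
    simp [homogenize_X]
  have h1 : (1 + X : R[X]).natDegree ≤ 1 := by compute_degree
  have hpow : ((1 + X : R[X]) ^ c).homogenize c = (.X 1 + .X 0) ^ c := by
    induction c with
    | zero => simp
    | succ c ih =>
      rw [pow_succ, homogenize_mul _ _ (natDegree_pow_le_of_le c h1 |>.trans (by simp)) h1, ih, hX,
        pow_succ]
  have huv : (C u + C v * X : R[X]).homogenize 1 = .C u * .X 1 + .C v * .X 0 := by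
    rw [homogenize_add, homogenize_C_mul, homogenize_C, homogenize_X one_ne_zero]; simp
  have h2 : (C u + C v * X : R[X]).natDegree ≤ 1 := by compute_degree
  have hc : ((1 + X : R[X]) ^ c).natDegree ≤ c := natDegree_pow_le_of_le c h1 |>.trans (by simp)
  have e : k + (c + 1) + r = (k + r) + (c + 1) := by omega
  rw [homSubst_succ, e, homogenize_mul _ _ ((natDegree_X_pow_le k).trans (by omega))
    (natDegree_mul_le_of_le hc h2), homogenize_mul _ _ hc h2, hpow, huv,
    homogenize_X_pow (by omega)]
  simp [add_comm a b]
end CoeffMatrix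

/-! ### Bordering the matrix of top coefficients and values -/

section Border
variable {R : Type*} [CommRing R]

/-- The `N × N` matrix whose row `i` consists of the coefficients of `P i` in degrees
`N + d - 1, …, d + 1`, followed by the value of `P i` at `ξ`. -/
def evalMatrix (ξ : R) (N d : ℕ) (P : ℕ → R[X]) : Matrix (Fin N) (Fin N) R :=
  Matrix.of fun i k =>
    if (k : ℕ) + 1 = N then (P i).eval ξ else (P i).coeff (N + d - 1 - (k : ℕ))

/-- For `d = 0` the value at `ξ` is the constant coefficient plus multiples of the other columns. -/
theorem det_evalMatrix_zero (ξ : R) (N : ℕ) (P : ℕ → R[X])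
    (hP : ∀ i < N, (P i).natDegree < N) :
    (evalMatrix ξ N 0 P).det = (coeffMatrix Fin.revPerm fun i : Fin N => P i).det := by
  cases N with
  | zero => simp
  | succ n =>
    have h : evalMatrix ξ (n + 1) 0 P =
        (coeffMatrix Fin.revPerm fun i : Fin (n + 1) => P i).updateCol (Fin.last n)
          (fun i => ∑ k : Fin (n + 1), ξ ^ (k.rev : ℕ) •
            (coeffMatrix Fin.revPerm fun i : Fin (n + 1) => P i) i k) := by
      ext i k
      by_cases hk : k = Fin.last n
      · subst hk
        rw [Matrix.updateCol_self, evalMatrix, Matrix.of_apply, if_pos (by simp),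
          eval_eq_sum_range' (hP i i.2), Finset.sum_range, ← Equiv.sum_comp Fin.revPerm]
        exact Finset.sum_congr rfl fun j _ => by simp [coeffMatrix, mul_comm]
      · have : (k : ℕ) ≠ n := fun h => hk (Fin.ext h)
        rw [Matrix.updateCol_ne hk]
        simp only [evalMatrix, coeffMatrix, Matrix.of_apply, Nat.add_right_cancel_iff, this,
          if_false, Fin.revPerm_apply, Fin.val_rev]
        congr 1
        omega
    rw [h, Matrix.det_updateCol_sum]
    simp

/-- Laplace expansion along the row of `(ξ - X) * X ^ d`, whose only nonzero entry is the
coefficient `-1` in degree `d + 1`. -/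
theorem det_evalMatrix_succ (ξ : R) (N d p : ℕ) (hp : p ≤ N) (Q : ℕ → R[X])
    (hQ : Q p = (C ξ - X) * X ^ d) (hN : 0 < N) :
    (evalMatrix ξ (N + 1) d Q).det =
      (-1) ^ (p + N) * (evalMatrix ξ N (d + 1) fun i => if i < p then Q i else Q (i + 1)).det := by
  obtain ⟨n, rfl⟩ : ∃ n, N = n + 1 := ⟨N - 1, by omega⟩
  rw [Matrix.det_succ_row _ (⟨p, by omega⟩ : Fin (n + 2)),
    Finset.sum_eq_single (⟨n, by omega⟩ : Fin (n + 2))]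
  · have h1 : evalMatrix ξ (n + 1 + 1) d Q ⟨p, by omega⟩ ⟨n, by omega⟩ = -1 := by
      have : n + 1 + 1 + d - 1 - n = d + 1 := by omega
      simp only [evalMatrix, Matrix.of_apply, hQ, this]
      rw [if_neg (by omega), sub_mul, ← pow_succ', coeff_sub, coeff_C_mul, coeff_X_pow, coeff_X_pow,
        if_neg (by omega), if_pos rfl, mul_zero, zero_sub]
    have h2 : (evalMatrix ξ (n + 1 + 1) d Q).submatrix
        (Fin.succAbove ⟨p, by omega⟩) (Fin.succAbove ⟨n, by omega⟩) =
        evalMatrix ξ (n + 1) (d + 1) fun i => if i < p then Q i else Q (i + 1) := by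
      ext i k
      have hrow : (((⟨p, by omega⟩ : Fin (n + 2)).succAbove i : Fin (n + 2)) : ℕ) =
          if (i : ℕ) < p then (i : ℕ) else i + 1 := by
        simp only [Fin.succAbove, Fin.lt_def, Fin.val_castSucc]; split_ifs <;> simp
      have hcol : (((⟨n, by omega⟩ : Fin (n + 2)).succAbove k : Fin (n + 2)) : ℕ) =
          if (k : ℕ) < n then (k : ℕ) else k + 1 := by
        simp only [Fin.succAbove, Fin.lt_def, Fin.val_castSucc]; split_ifs <;> simp
      have hQi : Q (if (i : ℕ) < p then (i : ℕ) else i + 1) =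
          if (i : ℕ) < p then Q i else Q (i + 1) := by split_ifs <;> rfl
      simp only [evalMatrix, Matrix.submatrix_apply, Matrix.of_apply, hrow, hcol, hQi]
      have hk := k.2
      by_cases hkn : (k : ℕ) < n
      · rw [if_pos hkn, if_neg (show ¬(k : ℕ) + 1 = n + 1 + 1 by omega),
          if_neg (show ¬(k : ℕ) + 1 = n + 1 by omega)]
        congr 1; omega
      · rw [if_neg hkn, if_pos (show (k : ℕ) + 1 + 1 = n + 1 + 1 by omega),
          if_pos (show (k : ℕ) + 1 = n + 1 by omega)]
    rw [h1, h2]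
    ring
  · intro k _ hk
    have hkn : (k : ℕ) ≠ n := fun h => hk (Fin.ext h)
    have : evalMatrix ξ (n + 1 + 1) d Q ⟨p, by omega⟩ k = 0 := by
      simp only [evalMatrix, Matrix.of_apply, hQ]
      split_ifs with h
      · simp
      · have h3 : n + 1 + 1 + d - 1 - (k : ℕ) ≠ d := by omega
        have h4 : n + 1 + 1 + d - 1 - (k : ℕ) ≠ d + 1 := by omega
        rw [sub_mul, ← pow_succ', coeff_sub, coeff_C_mul, coeff_X_pow, coeff_X_pow, if_neg h3,
          if_neg h4]
        simp
    simp [this]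
  · simp

/-- The rows of `(ξ - X) * X ^ k`, `k < d`, inserted at position `p`, border the matrix
`evalMatrix` to a full matrix of coefficients. -/
theorem det_evalMatrix (ξ : R) (p d : ℕ) (Q : ℕ → R[X]) :
    ∀ N, p ≤ N → 0 < N → (∀ i < N + d, (Q i).natDegree < N + d) →
      (∀ k < d, Q (p + k) = (C ξ - X) * X ^ k) →
      (evalMatrix ξ N d fun i => if i < p then Q i else Q (i + d)).det =
        (-1) ^ ((p + N) * d + d.choose 2) *
          (coeffMatrix Fin.revPerm fun i : Fin (N + d) => Q i).det := by
  induction d with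
  | zero =>
    intro N _ _ hdeg _
    simp only [add_zero, ite_self, mul_zero, Nat.choose_zero_succ, pow_zero, one_mul]
    exact det_evalMatrix_zero ξ N Q hdeg
  | succ d ih =>
    intro N hp hN hdeg hQ
    have e : N + 1 + d = N + (d + 1) := by omega
    have h1 := ih (N + 1) (by omega) (by omega) (by rwa [e]) fun k hk => hQ k (by omega)
    rw [e] at h1
    have h2 := det_evalMatrix_succ ξ N d p hp (fun i => if i < p then Q i else Q (i + d))
      (by simpa using hQ d (by omega)) hN
    have h3 : (fun i => if i < p then (fun i => if i < p then Q i else Q (i + d)) i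
        else (fun i => if i < p then Q i else Q (i + d)) (i + 1)) =
        fun i => if i < p then Q i else Q (i + (d + 1)) := by
      funext i
      by_cases hi : i < p
      · simp [hi]
      · simp [hi, show ¬ i + 1 < p by omega, show i + 1 + d = i + (d + 1) by omega]
    rw [h3, h1] at h2
    have h4 : ((-1 : R) ^ (p + N)) * (-1) ^ (p + N) = 1 := by
      rw [← mul_pow]; simp
    have h5 := congrArg (fun z => (-1 : R) ^ (p + N) * z) h2
    simp only [← mul_assoc, h4, one_mul] at h5
    rw [← h5, ← pow_add, Nat.choose_succ_succ', Nat.choose_one_right]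
    congr 2
    ring
end Border

/-! ### Expansion into Hankel minors -/

section HankelMinors
variable {A : Type*} [CommRing A]

/-- An instance of the Cauchy–Binet formula: the matrix on the right is the product of the Hankel
matrix with the bidiagonal `(d + 1) × d` matrix with entries `u` and `v`, whose maximal minors are
`u ^ j * v ^ (d - j)`. -/
theorem sum_hankelMinor [IsDomain A] (m n d : ℕ) (u v : A) (hu : u ≠ 0) :
    ∑ j : Fin (d + 1), ((hankelMinor m n d j : ℤ) : A) * (u ^ (j : ℕ) * v ^ (d - (j : ℕ))) =
      (Matrix.of fun i k : Fin d => u * ((binomHankel m n d i k.castSucc : ℤ) : A) +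
        v * ((binomHankel m n d i k.succ : ℤ) : A)).det := by
  -- the Hankel matrix, bordered by a row orthogonal to the columns of the bidiagonal matrix
  let H : Matrix (Fin (d + 1)) (Fin (d + 1)) A := Matrix.of
    (Fin.lastCases (motive := fun _ => Fin (d + 1) → A)
      (fun j => (-1) ^ (j : ℕ) * (u ^ (j : ℕ) * v ^ (d - (j : ℕ))))
      (fun i j => ((binomHankel m n d i j : ℤ) : A)))
  -- the bidiagonal matrix with `u` on the diagonal, `v` below it, and last column `(0, …, 0, 1)`
  let B : Matrix (Fin (d + 1)) (Fin (d + 1)) A := Matrix.of fun j =>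
    (Fin.lastCases (motive := fun _ => A) (if j = Fin.last d then 1 else 0)
      (fun k => if j = k.castSucc then u else if j = k.succ then v else 0))
  have hH : H.det = (-1) ^ d * ∑ j : Fin (d + 1),
      ((hankelMinor m n d j : ℤ) : A) * (u ^ (j : ℕ) * v ^ (d - (j : ℕ))) := by
    rw [Matrix.det_succ_row H (Fin.last d), Finset.mul_sum]
    refine Finset.sum_congr rfl fun j _ => ?_
    have hm : (H.submatrix (Fin.last d).succAbove j.succAbove).det =
        ((hankelMinor m n d j : ℤ) : A) := by
      rw [hankelMinor, Int.cast_det]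
      congr 1
      ext i k
      simp [H]
    rw [hm, pow_add]
    have : ((-1 : A) ^ (j : ℕ)) * (-1) ^ (j : ℕ) = 1 := by rw [← mul_pow]; simp
    simp only [H, Matrix.of_apply, Fin.lastCases_last, Fin.val_last]
    linear_combination ((-1) ^ d * (u ^ (j : ℕ) * v ^ (d - (j : ℕ))) *
      ((hankelMinor m n d j : ℤ) : A)) * this
  have hB : B.det = u ^ d := by
    rw [Matrix.det_of_isLowerTriangular, Fin.prod_univ_castSucc]
    · simp [B]
    · intro i j hij
      change i < j at hij
      induction j using Fin.lastCases with
      | last => simp [B, hij.ne]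
      | cast k =>
        have h1 : i ≠ k.castSucc := hij.ne
        have h2 : i ≠ k.succ := (hij.trans k.castSucc_lt_succ).ne
        simp [B, h1, h2]
  have hmul : ∀ i (k : Fin d), (H * B) i k.castSucc = u * H i k.castSucc + v * H i k.succ := by
    intro i k
    rw [Matrix.mul_apply, Finset.sum_eq_add k.castSucc k.succ k.castSucc_lt_succ.ne]
    · simp [B, k.castSucc_lt_succ.ne', mul_comm]
    · intro c _ hc
      simp [B, hc.1, hc.2]
    · simp
    · simp
  have hlast : ∀ i, (H * B) i (Fin.last d) = H i (Fin.last d) := by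
    intro i
    simp [Matrix.mul_apply, B]
  have hHB : (H * B).det = (-1) ^ d * u ^ d *
      (Matrix.of fun i k : Fin d => u * ((binomHankel m n d i k.castSucc : ℤ) : A) +
        v * ((binomHankel m n d i k.succ : ℤ) : A)).det := by
    rw [Matrix.det_succ_row _ (Fin.last d), Finset.sum_eq_single (Fin.last d)]
    · have : (H * B).submatrix (Fin.last d).succAbove (Fin.last d).succAbove =
          Matrix.of fun i k : Fin d => u * ((binomHankel m n d i k.castSucc : ℤ) : A) +
            v * ((binomHankel m n d i k.succ : ℤ) : A) := by
        ext i k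
        rw [Matrix.submatrix_apply, Fin.succAbove_last, hmul]
        simp [H]
      rw [this, hlast]
      simp [H]
    · intro j _ hj
      obtain ⟨k, rfl⟩ := Fin.exists_castSucc_eq.2 hj
      have e : d - (k : ℕ) = d - ((k : ℕ) + 1) + 1 := by omega
      have : (H * B) (Fin.last d) k.castSucc = 0 := by
        rw [hmul]
        simp only [H, Matrix.of_apply, Fin.lastCases_last, Fin.val_castSucc, Fin.val_succ]
        rw [e]
        ring
      rw [this, mul_zero, zero_mul]
    · simp
  rw [Matrix.det_mul, hH, hB] at hHB
  apply mul_left_cancel₀ (mul_ne_zero (pow_ne_zero d (neg_ne_zero.2 one_ne_zero)) (pow_ne_zero d hu))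
  linear_combination hHB
end HankelMinors

/-! ### Change of basis in the three blocks -/

section Blocks
variable {R : Type*} [CommRing R]

/-- The bijection of three consecutive blocks with `0, …, p + d + q - 1`, in which the first and
the last block are traversed backwards. -/
def blockEquiv (p d q : ℕ) : Fin p ⊕ Fin d ⊕ Fin q ≃ Fin (p + (d + q)) :=
  (Equiv.sumCongr Fin.revPerm ((Equiv.sumCongr (Equiv.refl _) Fin.revPerm).trans
    finSumFinEquiv)).trans finSumFinEquiv

@[simp] theorem blockEquiv_inl (p d q : ℕ) (i : Fin p) :
    (blockEquiv p d q (Sum.inl i) : ℕ) = p - 1 - i := by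
  simp [blockEquiv]; omega

@[simp] theorem blockEquiv_inr_inl (p d q : ℕ) (i : Fin d) :
    (blockEquiv p d q (Sum.inr (Sum.inl i)) : ℕ) = p + i := by
  simp [blockEquiv]

@[simp] theorem blockEquiv_inr_inr (p d q : ℕ) (i : Fin q) :
    (blockEquiv p d q (Sum.inr (Sum.inr i)) : ℕ) = p + (d + (q - 1 - i)) := by
  simp [blockEquiv]; omega

/-- The row polynomials `X ^ i * f`, `i < p`, then `(ξ - X) * X ^ k`, `k < d`, then `X ^ j * g`,
`j < q`. -/
noncomputable def blockRows (ξ : R) (f g : R[X]) (p d q : ℕ) : Fin p ⊕ Fin d ⊕ Fin q → R[X] :=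
  Sum.elim (fun i => X ^ (i : ℕ) * f)
    (Sum.elim (fun k => (C ξ - X) * X ^ (k : ℕ)) (fun j => X ^ (j : ℕ) * g))

theorem choose_two_block (p d q : ℕ) : (p + (d + q)).choose 2 =
    p.choose 2 + d.choose 2 + q.choose 2 + (p * q + p * d + d * q) := by
  have h : ∀ a b : ℕ, (a + b).choose 2 = a.choose 2 + b.choose 2 + a * b := by
    intro a b
    induction b with
    | zero => simp
    | succ b ih =>
      rw [← add_assoc, Nat.choose_succ_succ', Nat.choose_one_right, ih, Nat.choose_succ_succ' b,
        Nat.choose_one_right]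
      ring
  rw [h, h]
  ring

/-- A row of a pencil of degree `L - 1`, multiplied by `g`, in terms of the rows `X ^ j * g`. -/
theorem pencil_mul_eq_sum (α β : R) (L : ℕ) (g : R[X]) (i : Fin L) :
    (C α - X) ^ (i : ℕ) * (X - C β) ^ (L - 1 - (i : ℕ)) * g =
      ∑ j : Fin L, C (((C α - X) ^ (i : ℕ) * (X - C β) ^ (L - 1 - (i : ℕ))).coeff j) *
        (X ^ (j : ℕ) * g) := by
  have hd : ((C α - X) ^ (i : ℕ) * (X - C β) ^ (L - 1 - (i : ℕ)) : R[X]).natDegree < L := by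
    have h1 : (C α - X : R[X]).natDegree ≤ 1 := by compute_degree
    have h2 : (X - C β : R[X]).natDegree ≤ 1 := by compute_degree
    have h := natDegree_mul_le_of_le (natDegree_pow_le_of_le (i : ℕ) h1)
      (natDegree_pow_le_of_le (L - 1 - (i : ℕ)) h2)
    have := i.2
    omega
  conv_lhs => rw [as_sum_range_C_mul_X_pow' _ hd, Finset.sum_range, Finset.sum_mul]
  simp only [mul_assoc]

/-- Changing bases in the three blocks of rows, and in the space of polynomials of degree less than
`p + d + q`, to powers of `α - X` and `X - β` reduces the determinant to the middle block. -/
theorem det_blockRows_mul (α β ξ : R) (p d q : ℕ) (hp : 0 < p) (hq : 0 < q) :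
    ((-1) ^ (q + d)) ^ p * (-(α - β)) ^ (p.choose 2) *
        (((α - β) ^ (p + q)) ^ d * (-(α - β)) ^ (d.choose 2) * (-(α - β)) ^ (q.choose 2)) *
      (coeffMatrix ((blockEquiv p d q).trans Fin.revPerm)
        (blockRows ξ ((X - C α) ^ (q + d)) ((X - C β) ^ (p + d)) p d q)).det =
    (Matrix.of fun k l : Fin d => (X ^ (k : ℕ) * ((1 + X) ^ (p + q - 1) *
        (C (ξ - α) + C (ξ - β) * X))).coeff (d + q - 1 - (l : ℕ))).det *
      (-(α - β)) ^ ((p + (d + q)).choose 2) := by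
  set σ := (blockEquiv p d q).trans Fin.revPerm with hσ
  set a : R[X] := C α - X with ha
  set b : R[X] := X - C β with hb
  let T : (L : ℕ) → Matrix (Fin L) (Fin L) R := fun L =>
    coeffMatrix (Equiv.refl (Fin L)) fun i => a ^ (i : ℕ) * b ^ (L - 1 - (i : ℕ))
  have hT : ∀ L, (T L).det = (-(α - β)) ^ (L.choose 2) := fun L =>
    det_coeffMatrix_pencil a b α β ha hb L
  let h : Fin p ⊕ Fin d ⊕ Fin q → R[X] :=
    Sum.elim (fun i => X ^ (q + d + (i : ℕ)))
      (Sum.elim (fun k => X ^ (k : ℕ) * ((1 + X) ^ (p + q - 1) * (C (ξ - α) + C (ξ - β) * X)))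
        (fun j => X ^ (j : ℕ)))
  have hσ1 : ∀ i : Fin p, (σ (Sum.inl i) : ℕ) = q + d + i := by
    intro i; simp [hσ]; omega
  have hσ2 : ∀ i : Fin d, (σ (Sum.inr (Sum.inl i)) : ℕ) = d + q - 1 - i := by
    intro i; simp [hσ]; omega
  have hσ3 : ∀ i : Fin q, (σ (Sum.inr (Sum.inr i)) : ℕ) = i := by
    intro i; simp [hσ]; omega
  let c : Matrix (Fin p ⊕ Fin d ⊕ Fin q) (Fin p ⊕ Fin d ⊕ Fin q) R :=
    Matrix.fromBlocks ((-1 : R) ^ (q + d) • T p) 0 0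
      (Matrix.fromBlocks ((α - β) ^ (p + q) • T d) 0 0 (T q))
  have hc : c.det = ((-1) ^ (q + d)) ^ p * (-(α - β)) ^ (p.choose 2) *
      (((α - β) ^ (p + q)) ^ d * (-(α - β)) ^ (d.choose 2) * (-(α - β)) ^ (q.choose 2)) := by
    simp only [c, Matrix.det_fromBlocks_zero₂₁, Matrix.det_smul, Fintype.card_fin, hT]
  rw [← hc, ← Matrix.det_mul, ← coeffMatrix_eq_mul σ _
    (fun i => homSubst (p + (d + q)) a b (h i)) c, det_coeffMatrix_homSubst σ a b α β ha hb]
  · -- the matrix of coefficients of `h` is block triangular with two identity blocks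
    congr 1
    let S : Matrix (Fin d) (Fin d) R := Matrix.of fun k l => (X ^ (k : ℕ) * ((1 + X) ^ (p + q - 1) *
        (C (ξ - α) + C (ξ - β) * X))).coeff (d + q - 1 - (l : ℕ))
    have hblock : coeffMatrix σ h = Matrix.fromBlocks 1 0
        (Matrix.of fun i j => coeffMatrix σ h (Sum.inr i) (Sum.inl j))
        (Matrix.fromBlocks S
          (Matrix.of fun i j => coeffMatrix σ h (Sum.inr (Sum.inl i)) (Sum.inr (Sum.inr j)))
          0 1) := by
      ext i j
      rcases i with i | i | i <;> rcases j with j | j | j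
      · simp [coeffMatrix, h, hσ1, coeff_X_pow, Matrix.one_apply, Fin.ext_iff, eq_comm]
      · have : d + q - 1 - (j : ℕ) ≠ q + d + i := by omega
        simp [coeffMatrix, h, hσ2, coeff_X_pow, this]
      · have : (j : ℕ) ≠ q + d + i := by omega
        simp [coeffMatrix, h, hσ3, coeff_X_pow, this]
      · simp
      · simp [coeffMatrix, h, hσ2, S]
      · simp
      · simp
      · have : d + q - 1 - (j : ℕ) ≠ i := by omega
        simp [coeffMatrix, h, hσ2, coeff_X_pow, this]
      · simp [coeffMatrix, h, hσ3, coeff_X_pow, Matrix.one_apply, Fin.ext_iff, eq_comm]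
    rw [hblock, Matrix.det_fromBlocks_zero₁₂, Matrix.det_fromBlocks_zero₂₁]
    simp [S]
  · intro i
    rcases i with i | i | i
    · simp only [h, Sum.elim_inl, c, Fintype.sum_sum_type, Matrix.fromBlocks_apply₁₁,
        Matrix.fromBlocks_apply₁₂, Matrix.zero_apply, C_0, zero_mul, Finset.sum_const_zero,
        add_zero, blockRows, Matrix.smul_apply, smul_eq_mul, T, coeffMatrix, Matrix.of_apply,
        Equiv.refl_apply, C_mul, mul_assoc]
      rw [homSubst_X_pow _ _ (by omega), ← Finset.mul_sum,
        ← pencil_mul_eq_sum, ← ha, ← hb]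
      have e : p + (d + q) - 1 - (q + d + (i : ℕ)) = p - 1 - i := by omega
      have hneg : (C ((-1 : R) ^ (q + d)) : R[X]) * (X - C α) ^ (q + d) = a ^ (q + d) := by
        rw [C_pow, C_neg, C_1, ← mul_pow, ha]; ring
      rw [e, pow_add a, ← hneg]
      ring
    · simp only [h, Sum.elim_inl, Sum.elim_inr, c, Fintype.sum_sum_type, Matrix.fromBlocks_apply₁₁,
        Matrix.fromBlocks_apply₂₁, Matrix.fromBlocks_apply₂₂,
        Matrix.fromBlocks_apply₁₂, Matrix.zero_apply, C_0, zero_mul, Finset.sum_const_zero,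
        add_zero, zero_add, blockRows, Matrix.smul_apply, smul_eq_mul, T, coeffMatrix,
        Matrix.of_apply, Equiv.refl_apply, C_mul, mul_assoc]
      have e : p + (d + q) = (i : ℕ) + (p + q - 1 + 1) + (d - 1 - i) + 1 := by omega
      have e' : p + q = p + q - 1 + 1 := by omega
      have hab : a + b = C (α - β) := by rw [ha, hb, C_sub]; ring
      have hx : C (ξ - α) * b + C (ξ - β) * a = C (α - β) * (C ξ - X) := by
        rw [ha, hb]; simp only [C_sub]; ring
      have hs := pencil_mul_eq_sum α β d (C ξ - X) i
      rw [← ha, ← hb] at hs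
      rw [e, homSubst_binomial, hab, hx, ← Finset.mul_sum]
      simp only [mul_comm (C ξ - X)]
      rw [← hs, C_pow]
      conv_rhs => rw [e', pow_succ]
      ring
    · simp only [h, Sum.elim_inr, c, Fintype.sum_sum_type,
        Matrix.fromBlocks_apply₂₁, Matrix.fromBlocks_apply₂₂,
        Matrix.zero_apply, C_0, zero_mul, Finset.sum_const_zero,
        zero_add, blockRows, T, coeffMatrix,
        Matrix.of_apply, Equiv.refl_apply]
      rw [homSubst_X_pow _ _ (by omega), ha, hb, ← pencil_mul_eq_sum]
      have e : p + (d + q) - 1 - (i : ℕ) = (q - 1 - i) + (p + d) := by omega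
      rw [e, pow_add, mul_assoc]
end Blocks

/-! ### Subresultants of powers of linear polynomials -/

section Subresultant
variable {A : Type*} [CommRing A]

/-- The middle coefficients left over by the change of basis are combinations of adjacent entries
of the Hankel matrix. -/
theorem coeff_binomial_mul (u v : A) (m n d : ℕ) (k l : Fin d) (hm : d < m) :
    (X ^ (k : ℕ) * ((1 + X) ^ (m + n - 2 * d - 1) * (C u + C v * X))).coeff (m - 1 - (l : ℕ)) =
      u * ((binomHankel m n d l k.castSucc : ℤ) : A) +
        v * ((binomHankel m n d l k.succ : ℤ) : A) := by
  have hl := l.2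
  set c := m + n - 2 * d - 1 with hc
  have hu : (binomHankel m n d l k.castSucc : ℤ) =
      if (k : ℕ) ≤ m - 1 - l then (c.choose (m - 1 - l - k) : ℤ) else 0 := by
    simp only [binomHankel, Matrix.of_apply, intBinom, Fin.val_castSucc, ← hc]
    split_ifs with h1 h2 h2
    · congr 2; omega
    · omega
    · omega
    · rfl
  have hv : (binomHankel m n d l k.succ : ℤ) =
      if (k : ℕ) + 1 ≤ m - 1 - l then (c.choose (m - 1 - l - (k + 1)) : ℤ) else 0 := by
    simp only [binomHankel, Matrix.of_apply, intBinom, Fin.val_succ, ← hc]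
    split_ifs with h1 h2 h2
    · congr 2; omega
    · omega
    · omega
    · rfl
  have e : (X ^ (k : ℕ) * ((1 + X) ^ c * (C u + C v * X)) : A[X]) =
      C u * (X ^ (k : ℕ) * (1 + X) ^ c) + C v * (X ^ ((k : ℕ) + 1) * (1 + X) ^ c) := by ring
  rw [e, coeff_add, coeff_C_mul, coeff_C_mul, coeff_X_pow_mul', coeff_X_pow_mul', hu, hv]
  simp only [coeff_one_add_X_pow]
  push_cast
  rfl

/-- Over `A[X][X]` the outer variable plays the role of `t`, and evaluation at the inner `X` gives
back the polynomial in the last column. -/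
theorem sresRow_eq (h : A[X]) (e L N : ℕ) (i : Fin L) (k : Fin N) (hN : N ≤ L + e) :
    sresRow h e L N i k =
      if (k : ℕ) + 1 = N then (X ^ (L - 1 - (i : ℕ)) * h.map C : A[X][X]).eval X
      else (X ^ (L - 1 - (i : ℕ)) * h.map C : A[X][X]).coeff (L + e - 1 - (k : ℕ)) := by
  have hi := i.2
  have hk := k.2
  rw [sresRow]
  split_ifs
  · simp [eval_map]
  · rw [coeff_X_pow_mul', coeff_map, intCoeff]
    split_ifs with h1 h2 h2
    · congr 2; omega
    · omega
    · omega
    · simp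

/-- The subresultant matrix is the matrix of top coefficients and values at `X` of the polynomials
`X ^ i * f` and `X ^ j * g`, taken over `A[X]`. -/
theorem det_sresMatrix (f g : A[X]) (m n d : ℕ) (hm : d < m) (hn : d < n)
    (hf : f.natDegree ≤ m) (hg : g.natDegree ≤ n) :
    (sresMatrix f g m n d).det =
      (-1) ^ ((m - d) * d + d.choose 2) *
        (coeffMatrix ((blockEquiv (n - d) d (m - d)).trans Fin.revPerm)
          (blockRows (X : A[X]) (f.map C) (g.map C) (n - d) d (m - d))).det := by
  obtain ⟨p, rfl⟩ : ∃ p, n = p + d := ⟨n - d, by omega⟩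
  obtain ⟨q, rfl⟩ : ∃ q, m = q + d := ⟨m - d, by omega⟩
  have ep : p + d - d = p := by omega
  have eq' : q + d - d = q := by omega
  let Q : ℕ → A[X][X] := fun i =>
    if i < p then X ^ (p - 1 - i) * f.map C
    else if i < p + d then (C X - X) * X ^ (i - p)
    else X ^ (q - 1 - (i - p - d)) * g.map C
  have h1 : (sresMatrix f g (q + d) (p + d) d).det =
      (evalMatrix (X : A[X]) (p + q) d fun i => if i < p then Q i else Q (i + d)).det := by
    rw [sresMatrix, ep, eq']
    congr 1
    ext1 i k
    induction i using Fin.addCases with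
    | left i =>
      simp only [Matrix.of_apply, Fin.addCases_left, evalMatrix, Fin.val_castAdd, Q, i.2, if_true]
      rw [sresRow_eq _ _ _ _ _ _ (by omega), show p + (q + d) = p + q + d by omega]
    | right i =>
      have e2 : p + (i : ℕ) + d - p - d = i := by omega
      simp only [Matrix.of_apply, Fin.addCases_right, evalMatrix, Fin.val_natAdd, Q,
        show ¬ p + (i : ℕ) < p by omega, show ¬ p + (i : ℕ) + d < p by omega,
        show ¬ p + (i : ℕ) + d < p + d by omega, if_false, e2]
      rw [sresRow_eq _ _ _ _ _ _ (by omega), show q + (p + d) = p + q + d by omega]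
  have hdeg : ∀ i < p + q + d, (Q i).natDegree < p + q + d := by
    intro i hi
    simp only [Q]
    split_ifs with h h'
    · have := natDegree_mul_le_of_le (natDegree_X_pow_le (R := A[X]) (p - 1 - i))
        ((natDegree_map_le (p := f) (f := C)).trans hf)
      omega
    · have hX : (C X - X : A[X][X]).natDegree ≤ 1 := by compute_degree
      have := natDegree_mul_le_of_le hX (natDegree_X_pow_le (R := A[X]) (i - p))
      omega
    · have := natDegree_mul_le_of_le (natDegree_X_pow_le (R := A[X]) (q - 1 - (i - p - d)))
        ((natDegree_map_le (p := g) (f := C)).trans hg)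
      omega
  have hb : ∀ k < d, Q (p + k) = (C X - X) * X ^ k := by
    intro k hk
    simp [Q, hk]
  have hsign : (-1 : A[X]) ^ ((p + (p + q)) * d + d.choose 2) = (-1) ^ (q * d + d.choose 2) := by
    rw [show (p + (p + q)) * d + d.choose 2 = 2 * (p * d) + (q * d + d.choose 2) by ring, pow_add,
      pow_mul]
    simp
  rw [h1, det_evalMatrix X p d Q (p + q) (by omega) (by omega) hdeg hb, ep, eq', hsign,
    show p + q + d = p + (d + q) by omega, ← Matrix.det_submatrix_equiv_self (blockEquiv p d q)]
  congr 2
  ext1 i j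
  have hrow : Q (blockEquiv p d q i) = blockRows X (f.map C) (g.map C) p d q i := by
    rcases i with i | i | i
    · simp only [Q, blockRows, blockEquiv_inl, Sum.elim_inl]
      rw [if_pos (by omega)]
      congr 2; omega
    · simp [Q, blockRows]
    · simp only [Q, blockRows, blockEquiv_inr_inr, Sum.elim_inr]
      rw [if_neg (by omega), if_neg (by omega)]
      congr 2; omega
  simp [coeffMatrix, hrow]

/-- The formula over a domain, for `α ≠ β`, where powers of `α - β` can be cancelled. -/
theorem det_sresMatrix_of_ne [IsDomain A] (m n d : ℕ) (hm : d < m) (hn : d < n) (α β : A)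
    (hαβ : α ≠ β) :
    (sresMatrix ((X - C α) ^ m) ((X - C β) ^ n) m n d).det =
      (-1) ^ (d.choose 2) * C ((α - β) ^ ((m - d) * (n - d))) *
        ∑ j : Fin (d + 1), C ((hankelMinor m n d j : ℤ) : A) *
          ((X - C α) ^ (j : ℕ) * (X - C β) ^ (d - (j : ℕ))) := by
  have hS : (Matrix.of fun k l : Fin d => (X ^ (k : ℕ) * ((1 + X) ^ (n - d + (m - d) - 1) *
      (C (X - C α) + C (X - C β) * X)) : A[X][X]).coeff (d + (m - d) - 1 - (l : ℕ))).det =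
      ∑ j : Fin (d + 1), C ((hankelMinor m n d j : ℤ) : A) *
          ((X - C α) ^ (j : ℕ) * (X - C β) ^ (d - (j : ℕ))) := by
    simp only [map_intCast]
    rw [sum_hankelMinor m n d (X - C α) (X - C β) (X_sub_C_ne_zero α), ← Matrix.det_transpose]
    congr 1
    ext1 l k
    rw [Matrix.transpose_apply, Matrix.of_apply, Matrix.of_apply,
      ← coeff_binomial_mul _ _ m n d k l hm,
      show n - d + (m - d) - 1 = m + n - 2 * d - 1 by omega, show d + (m - d) = m by omega]
  have hmul := det_blockRows_mul (C α) (C β) (X : A[X]) (n - d) d (m - d) (by omega) (by omega)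
  rw [det_sresMatrix _ _ m n d hm hn (natDegree_pow_le_of_le m (natDegree_X_sub_C_le α) |>.trans
    (by simp)) (natDegree_pow_le_of_le n (natDegree_X_sub_C_le β) |>.trans (by simp))]
  simp only [Polynomial.map_pow, Polynomial.map_sub, map_X, map_C]
  rw [hS, choose_two_block, Nat.sub_add_cancel hm.le, Nat.sub_add_cancel hn.le] at hmul
  rw [C_pow, C_sub]
  have hΔ : (C α - C β : A[X]) ≠ 0 := sub_ne_zero.2 fun h => hαβ (C_injective h)
  generalize (∑ j : Fin (d + 1), C ((hankelMinor m n d j : ℤ) : A) *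
          ((X - C α) ^ (j : ℕ) * (X - C β) ^ (d - (j : ℕ)))) = S at *
  generalize (coeffMatrix ((blockEquiv (n - d) d (m - d)).trans Fin.revPerm)
    (blockRows (X : A[X]) ((X - C (C α)) ^ m) ((X - C (C β)) ^ n) (n - d) d (m - d))).det = D at *
  obtain ⟨p, rfl⟩ : ∃ p, n = p + d := ⟨n - d, by omega⟩
  obtain ⟨q, rfl⟩ : ∃ q, m = q + d := ⟨m - d, by omega⟩
  simp only [Nat.add_sub_cancel] at *
  generalize (C α - C β : A[X]) = δ at *
  -- both sides of `hmul` are divided by the powers of `-δ` from the three blocks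
  have h1 : ((-1) ^ (q + d)) ^ p * (δ ^ (p + q)) ^ d * D =
      S * (-δ) ^ (p * q + p * d + d * q) := by
    apply mul_left_cancel₀ (pow_ne_zero (p.choose 2 + d.choose 2 + q.choose 2) (neg_ne_zero.2 hΔ))
    rw [pow_add (-δ) _ (p * q + p * d + d * q)] at hmul
    linear_combination hmul
  have h2 : D = (-1) ^ (q * d) * δ ^ (q * p) * S := by
    apply mul_left_cancel₀ (mul_ne_zero (pow_ne_zero ((q + d) * p) (neg_ne_zero.2 (one_ne_zero' A[X])))
      (pow_ne_zero ((p + q) * d) hΔ))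
    have h3 := h1
    rw [neg_pow δ, ← pow_mul, ← pow_mul] at h3
    rw [h3]
    ring
  have h4 : ((-1 : A[X]) ^ (q * d)) * (-1) ^ (q * d) = 1 := by rw [← mul_pow]; simp
  rw [h2, pow_add]
  linear_combination ((-1) ^ d.choose 2 * δ ^ (q * p) * S) * h4

theorem sresMatrix_map {B : Type*} [CommRing B] (φ : A →+* B) (f g : A[X]) (m n d : ℕ) :
    (sresMatrix f g m n d).map (mapRingHom φ) = sresMatrix (f.map φ) (g.map φ) m n d := by
  have hrow : ∀ (h : A[X]) (e L N : ℕ) (i : Fin L) (k : Fin N),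
      (sresRow h e L N i k).map φ = sresRow (h.map φ) e L N i k := by
    intro h e L N i k
    simp only [sresRow, intCoeff]
    split_ifs <;> simp
  ext1 i k
  rw [Matrix.map_apply, coe_mapRingHom]
  induction i using Fin.addCases with
  | left i => simp [sresMatrix, hrow]
  | right i => simp [sresMatrix, hrow]
end Subresultant

theorem theorem1 {K : Type*} [Field K] (m n d : ℕ) (hd : d < min m n) (α β : K) :
    sres d ((X - C α) ^ m) ((X - C β) ^ n) =
      (-1) ^ (d.choose 2) * C ((α - β) ^ ((m - d) * (n - d))) *
        ∑ j : Fin (d + 1),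
          C ((hankelMinor m n d j : ℤ) : K) *
            ((X - C α) ^ (j : ℕ) * (X - C β) ^ (d - (j : ℕ))) := by
  obtain ⟨hm, hn⟩ := lt_min_iff.1 hd
  rw [sres, natDegree_pow, natDegree_pow, natDegree_X_sub_C, natDegree_X_sub_C, mul_one, mul_one]
  -- deform `α` to `α + Y` over `K[Y]`, which differs from `β`, and specialize `Y` to `0`
  have hne : (C α + X : K[X]) ≠ C β := by
    intro h
    simpa using congrArg (fun P : K[X] => P.coeff 1) h
  have h := congrArg (mapRingHom (evalRingHom (0 : K)))
    (det_sresMatrix_of_ne m n d hm hn (C α + X) (C β) hne)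
  rw [RingHom.map_det, RingHom.mapMatrix_apply, sresMatrix_map] at h
  simpa [Polynomial.map_sum] using h
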